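/- Let $s>0$, $t>0$ and $u:=s+it$. Let $L$ be the operator in $L^2((0,\pi),{\bf C}^2)$ given by $$(Lf)_1(x)=u f_1'(x),\qquad (Lf)_2(x)=\overline{u}\, f_2'(x),$$ with domain the set of all $f\in W^{1,2}((0,\pi),{\bf C}^2)$ that satisfy the boundary conditions $f_1(0)=f_2(0)$ and $f_1(\pi)=f_2(\pi)$. For $n\in{\bf Z}$ put $$\lambda_n=\frac{(s^2+t^2)n}{t},\qquad f_n(x)=\left({\rm e}^{x\lambda_n/u},\ {\rm e}^{x\lambda_n/\overline{u}}\right).$$ Then each $f_n$ is an eigenfunction of $L$ with eigenvalue $\lambda_n$; conversely, every eigenvalue of $L$ is one of the $\lambda_n$, and the corresponding eigenfunctions are the multiples of $f_n$; and the set of eigenfunctions $\{f_n\}_{n\in{\bf Z}}$ is complete, in the sense that its linear span is dense in $L^2((0,\pi),{\bf C}^2)$. -/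

import Mathlib

open MeasureTheory Set Filter Topology
open scoped ContDiff ComplexConjugate

noncomputable section

/-- The coordinate space `ℂ²` with its Euclidean norm. -/
abbrev C2 : Type := EuclideanSpace ℂ (Fin 2)

/-- Lebesgue measure on the open interval `(0, π)`. -/
abbrev muI : Measure ℝ := volume.restrict (Ioo 0 Real.pi)

/-- The Hilbert space `L²((0, π), ℂ²)`. -/
abbrev L2C2 : Type := Lp C2 2 muI

/-- `g` is the weak derivative of `f` on `(0, π)`:
`∫ η' f = - ∫ η g` for all smooth `η` with compact support contained in `(0, π)`. -/
def IsWeakDeriv (f g : L2C2) : Prop :=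
  ∀ η : ℝ → ℝ, ContDiff ℝ ∞ η → HasCompactSupport η → tsupport η ⊆ Ioo 0 Real.pi →
    ∫ x, deriv η x • f x ∂muI = - ∫ x, η x • g x ∂muI

/-- The boundary conditions `f₁(0) = f₂(0)` and `f₁(π) = f₂(π)`, read off from the
representative of `f` that is continuous on `[0, π]` (two such representatives agree on
`[0, π]`, and every element of `W^{1,2}` has one). -/
def SatisfiesBC (f : L2C2) : Prop :=
  ∃ φ : ℝ → C2, ContinuousOn φ (Icc 0 Real.pi) ∧ f =ᵐ[muI] φ ∧
    φ 0 0 = φ 0 1 ∧ φ Real.pi 0 = φ Real.pi 1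

lemma integrable_smul_L2C2 (η : ℝ → ℝ) (hη : Continuous η) (hc : HasCompactSupport η)
    (f : L2C2) : Integrable (fun x => η x • f x) muI := by
  have hf : Integrable f muI := (Lp.memLp f).integrable (by norm_num)
  obtain ⟨C, hC⟩ := hc.exists_bound_of_continuous hη
  exact hf.bdd_smul C hη.aestronglyMeasurable (ae_of_all _ hC)

lemma IsWeakDeriv.add {f g f' g' : L2C2} (h : IsWeakDeriv f g) (h' : IsWeakDeriv f' g') :
    IsWeakDeriv (f + f') (g + g') := by
  intro η h1 h2 h3
  have hd : Continuous (deriv η) := h1.continuous_deriv (by simp)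
  have e1 : ∫ x, deriv η x • (f + f' : L2C2) x ∂muI
      = ∫ x, (deriv η x • f x + deriv η x • f' x) ∂muI := by
    refine integral_congr_ae ?_
    filter_upwards [Lp.coeFn_add f f'] with x hx
    rw [hx, Pi.add_apply, smul_add]
  have e2 : ∫ x, η x • (g + g' : L2C2) x ∂muI
      = ∫ x, (η x • g x + η x • g' x) ∂muI := by
    refine integral_congr_ae ?_
    filter_upwards [Lp.coeFn_add g g'] with x hx
    rw [hx, Pi.add_apply, smul_add]
  rw [e1, e2, integral_add (integrable_smul_L2C2 _ hd h2.deriv _)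
    (integrable_smul_L2C2 _ hd h2.deriv _), integral_add
    (integrable_smul_L2C2 _ h1.continuous h2 _) (integrable_smul_L2C2 _ h1.continuous h2 _),
    h η h1 h2 h3, h' η h1 h2 h3]
  abel

lemma IsWeakDeriv.smul {f g : L2C2} (c : ℂ) (h : IsWeakDeriv f g) :
    IsWeakDeriv (c • f) (c • g) := by
  intro η h1 h2 h3
  have e1 : ∫ x, deriv η x • (c • f : L2C2) x ∂muI
      = ∫ x, c • (deriv η x • f x) ∂muI := by
    refine integral_congr_ae ?_
    filter_upwards [Lp.coeFn_smul c f] with x hx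
    simp only [hx, Pi.smul_apply]
    exact smul_comm _ _ _
  have e2 : ∫ x, η x • (c • g : L2C2) x ∂muI = ∫ x, c • (η x • g x) ∂muI := by
    refine integral_congr_ae ?_
    filter_upwards [Lp.coeFn_smul c g] with x hx
    simp only [hx, Pi.smul_apply]
    exact smul_comm _ _ _
  rw [e1, e2, integral_smul, integral_smul, h η h1 h2 h3, smul_neg]

lemma integral_smul_zero_L2C2 (ζ : ℝ → ℝ) : ∫ x, ζ x • (0 : L2C2) x ∂muI = 0 := by
  rw [← integral_zero ℝ C2 (μ := muI)]
  refine integral_congr_ae ?_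
  filter_upwards [Lp.coeFn_zero C2 2 muI] with x hx
  rw [hx, Pi.zero_apply, smul_zero]

lemma isWeakDeriv_zero : IsWeakDeriv 0 0 := by
  intro η _ _ _
  rw [integral_smul_zero_L2C2, integral_smul_zero_L2C2, neg_zero]

/-- Weak derivatives are unique. -/
lemma IsWeakDeriv.eq_zero {g : L2C2} (h : IsWeakDeriv 0 g) : g = 0 := by
  have hg : Integrable g muI := (Lp.memLp g).integrable (by norm_num)
  have hloc : LocallyIntegrableOn g (Ioo 0 Real.pi) volume :=
    IntegrableOn.locallyIntegrableOn hg
  have key := IsOpen.ae_eq_zero_of_integral_contDiff_smul_eq_zero isOpen_Ioo hloc ?_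
  · refine Lp.ext ?_
    have : ∀ᵐ x ∂muI, g x = 0 := by
      rw [ae_restrict_iff' measurableSet_Ioo]; exact key
    filter_upwards [this, Lp.coeFn_zero C2 2 muI] with x hx hx0
    rw [hx, hx0]; rfl
  · intro η h1 h2 h3
    have := h η h1 h2 h3
    rw [integral_smul_zero_L2C2] at this
    have h4 : ∫ x in Ioo 0 Real.pi, η x • g x = 0 := by
      simpa using this.symm
    rw [← h4]
    refine (setIntegral_eq_integral_of_forall_compl_eq_zero fun x hx => ?_).symm
    rw [image_eq_zero_of_notMem_tsupport fun h => hx (h3 h), zero_smul]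

/-- The number `u = s + i t`. -/
def uPar (s t : ℝ) : ℂ := s + t * Complex.I

/-- The graph of the operator `L`: pairs `(f, h)` such that `f ∈ W^{1,2}((0, π), ℂ²)`
(that is, `f` has a weak derivative `g` in `L²`), `f` satisfies the boundary conditions, and
`h₁ = u g₁`, `h₂ = ū g₂`. -/
def graphL (s t : ℝ) : Submodule ℂ (L2C2 × L2C2) where
  carrier := {p | SatisfiesBC p.1 ∧ ∃ g : L2C2, IsWeakDeriv p.1 g ∧
    ∀ᵐ x ∂muI, p.2 x 0 = uPar s t * g x 0 ∧ p.2 x 1 = conj (uPar s t) * g x 1}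
  add_mem' := by
    rintro ⟨f, h⟩ ⟨f', h'⟩ ⟨⟨φ, c, e, b0, b1⟩, g, hg, hh⟩ ⟨⟨φ', c', e', b0', b1'⟩, g', hg', hh'⟩
    refine ⟨⟨φ + φ', c.add c', ?_, by simp [b0, b0'], by simp [b1, b1']⟩, g + g',
      hg.add hg', ?_⟩
    · exact (Lp.coeFn_add f f').trans (e.add e')
    · filter_upwards [hh, hh', Lp.coeFn_add h h', Lp.coeFn_add g g'] with x a a' q q'
      simp only [Prod.mk_add_mk, q, q', Pi.add_apply, PiLp.add_apply, a.1, a.2, a'.1, a'.2]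
      constructor <;> ring
  zero_mem' := by
    refine ⟨⟨0, continuousOn_const, Lp.coeFn_zero C2 2 muI, rfl, rfl⟩, 0, isWeakDeriv_zero, ?_⟩
    filter_upwards [Lp.coeFn_zero C2 2 muI] with x hx
    simp only [Prod.snd_zero, hx, Pi.zero_apply, PiLp.zero_apply, mul_zero, and_self]
  smul_mem' := by
    rintro c ⟨f, h⟩ ⟨⟨φ, hc, e, b0, b1⟩, g, hg, hh⟩
    refine ⟨⟨c • φ, hc.const_smul c, ?_, by simp [b0], by simp [b1]⟩, c • g, hg.smul c, ?_⟩
    · exact (Lp.coeFn_smul c f).trans (e.const_smul c)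
    · filter_upwards [hh, Lp.coeFn_smul c h, Lp.coeFn_smul c g] with x a q q'
      simp only [Prod.smul_mk, q, q', Pi.smul_apply, PiLp.smul_apply, a.1, a.2, smul_eq_mul]
      constructor <;> ring

/-- The operator `L` in `L²((0, π), ℂ²)`: `(L f)₁ = u f₁'`, `(L f)₂ = ū f₂'`, with domain
the `f ∈ W^{1,2}((0, π), ℂ²)` such that `f₁(0) = f₂(0)` and `f₁(π) = f₂(π)`. -/
def opL (s t : ℝ) : L2C2 →ₗ.[ℂ] L2C2 := (graphL s t).toLinearPMap

lemma graphL_single (s t : ℝ) : ∀ p ∈ graphL s t, p.1 = 0 → p.2 = 0 := by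
  rintro ⟨f, h⟩ ⟨-, g, hg, hh⟩ (rfl : f = 0)
  have hg0 := hg.eq_zero
  subst hg0
  refine Lp.ext ?_
  filter_upwards [hh, Lp.coeFn_zero C2 2 muI] with x a q
  simp only [q, Pi.zero_apply, PiLp.zero_apply, mul_zero] at a
  ext i
  fin_cases i
  · rw [q]; exact a.1
  · rw [q]; exact a.2

/-- The graph of `opL s t` is `graphL s t`. -/
lemma graph_opL (s t : ℝ) : (opL s t).graph = graphL s t :=
  Submodule.toLinearPMap_graph_eq _ (graphL_single s t)

/-- `f` is an eigenvector of the unbounded operator `T` with eigenvalue `z`. -/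
def IsEigenvector (T : L2C2 →ₗ.[ℂ] L2C2) (z : ℂ) (f : L2C2) : Prop :=
  f ≠ 0 ∧ ∃ hf : f ∈ T.domain, T ⟨f, hf⟩ = z • f

/-- The numbers `λ_n = (s² + t²) n / t`. -/
def eigval (s t : ℝ) (n : ℤ) : ℝ := (s ^ 2 + t ^ 2) * n / t

/-- The functions `f_n(x) = (exp (x λ_n / u), exp (x λ_n / ū))`. -/
def eigfunFun (s t : ℝ) (n : ℤ) (x : ℝ) : C2 :=
  !₂[Complex.exp (x * eigval s t n / uPar s t),
    Complex.exp (x * eigval s t n / conj (uPar s t))]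

lemma continuous_eigfunFun (s t : ℝ) (n : ℤ) : Continuous (eigfunFun s t n) := by
  unfold eigfunFun
  refine (PiLp.continuous_toLp 2 _).comp (continuous_pi fun i => ?_)
  fin_cases i
  · simp only [div_eq_mul_inv]; simp; fun_prop
  · simp only [div_eq_mul_inv]; simp; fun_prop

lemma memLp_eigfunFun (s t : ℝ) (n : ℤ) : MemLp (eigfunFun s t n) 2 muI := by
  obtain ⟨C, hC⟩ := (isCompact_Icc (a := (0 : ℝ)) (b := Real.pi)).exists_bound_of_continuousOn
    (continuous_eigfunFun s t n).continuousOn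
  refine MemLp.of_bound (continuous_eigfunFun s t n).aestronglyMeasurable C ?_
  filter_upwards [ae_restrict_mem measurableSet_Ioo] with x hx
  exact hC x (Ioo_subset_Icc_self hx)

/-- `f_n` as an element of `L²((0, π), ℂ²)`. -/
def eigfun (s t : ℝ) (n : ℤ) : L2C2 := (memLp_eigfunFun s t n).toLp _

end

/-! Completeness: let `G` be orthogonal to all `f_n` and put α = s/t + i. The components of `f_n`
are the n-th powers of exp(ᾱx) and exp(αx), so all moments (n ∈ ℤ) of `G` vanish on the pair of arcs
exp(αx), exp(ᾱx), 0 ≤ x ≤ π. Both arcs run from 1 to -exp(πs/t); together they form a closed curve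
around 0 that every ray from 0 meets once.

Integration by parts turns the components of `G` into continuous densities p, q whose moments agree
for n ≠ 0. Hence their Cauchy integral over the curve is constant near 0 and zero near infinity, and
continuation along rays carries this up to the curve from both sides. The jump at a point is
proportional to the density there, so q is constant (`eq_of_spiralMoment_eq`) and its derivative, a
component of `G` up to sign, vanishes. Exchanging α and ᾱ gives the other component.

Eigenvalues: the components of an eigenfunction solve f' = κf weakly, so they are multiples of
exponentials (`IsWeakDerivC.ae_eq_mul_spiral`). The condition at 0 equates the two coefficients, and
the condition at π makes the eigenvalue one of the λ_n. -/

/-! ### Integration by parts for integrable functions. -/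

/-- The integral of a complex-valued integrable function is absolutely continuous. -/
lemma absolutelyContinuousOnInterval_integral_complex {g : ℝ → ℂ} {a b : ℝ}
    (hg : IntervalIntegrable g volume a b) :
    AbsolutelyContinuousOnInterval (fun x => ∫ y in a..x, g y) a b := by
  have hre : IntervalIntegrable (fun x => (g x).re) volume a b :=
    ⟨hg.1.re, hg.2.re⟩
  have him : IntervalIntegrable (fun x => (g x).im) volume a b :=
    ⟨hg.1.im, hg.2.im⟩
  have hc (z : ℂ) : AbsolutelyContinuousOnInterval (fun _ : ℝ => z) a b :=
    (contDiff_const (n := 1)).contDiffOn.absolutelyContinuousOnInterval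
  have h1 := (hre.absolutelyContinuousOnInterval_intervalIntegral
    (c := a) (by simp)).smul (hc 1)
  have h2 := (him.absolutelyContinuousOnInterval_intervalIntegral
    (c := a) (by simp)).smul (hc Complex.I)
  have h3 := h1.add h2
  rw [absolutelyContinuousOnInterval_iff] at h3 ⊢
  have key : ∀ x ∈ uIcc a b, (∫ y in a..x, g y) =
      (((fun x => ∫ y in a..x, (g y).re) • fun _ : ℝ => (1 : ℂ)) +
        ((fun x => ∫ y in a..x, (g y).im) • fun _ : ℝ => Complex.I)) x := by
    intro x hx
    have hr : IntervalIntegrable g volume a x :=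
      hg.mono_set (uIcc_subset_uIcc left_mem_uIcc hx)
    have e1 : ∫ y in a..x, (g y).re = (∫ y in a..x, g y).re :=
      Complex.reCLM.intervalIntegral_comp_comm hr
    have e2 : ∫ y in a..x, (g y).im = (∫ y in a..x, g y).im :=
      Complex.imCLM.intervalIntegral_comp_comm hr
    simp only [Pi.add_apply, Pi.smul_apply', e1, e2]
    simp
  intro ε hε
  obtain ⟨δ, hδ, h⟩ := h3 ε hε
  refine ⟨δ, hδ, fun E hE hs => ?_⟩
  refine lt_of_eq_of_lt (Finset.sum_congr rfl fun i hi => ?_) (h E hE hs)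
  have := hE.1 i hi
  rw [key _ this.1, key _ this.2]

/-- Integration by parts against the primitive of an integrable function. -/
lemma integral_mul_eq_sub_integral_deriv_mul_primitive {v v' g : ℝ → ℂ} {a b : ℝ}
    (hv : ∀ x, HasDerivAt v (v' x) x) (hv' : Continuous v')
    (hg : IntervalIntegrable g volume a b) :
    ∫ x in a..b, v x * g x =
      v b * (∫ x in a..b, g x) - ∫ x in a..b, v' x * ∫ y in a..x, g y := by
  have hvc : Continuous v := continuous_iff_continuousAt.2 fun x => (hv x).continuousAt
  have hvC : ContDiff ℝ 1 v := by
    rw [contDiff_one_iff_deriv]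
    exact ⟨fun x => (hv x).differentiableAt, by rwa [funext fun x => (hv x).deriv]⟩
  have hP := absolutelyContinuousOnInterval_integral_complex hg
  have i1 : IntervalIntegrable (fun x => v x * g x) volume a b :=
    hg.continuousOn_mul hvc.continuousOn
  have i2 : IntervalIntegrable (fun x => v' x * ∫ y in a..x, g y) volume a b :=
    (hv'.continuousOn.mul hP.continuousOn).intervalIntegrable
  -- With P the primitive of g, vP minus the primitive of vg + v'P is absolutely continuous with
  -- derivative zero a.e., hence constant.
  have hAC := (hvC.contDiffOn.absolutelyContinuousOnInterval.smul hP).sub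
    (absolutelyContinuousOnInterval_integral_complex (i1.add i2))
  obtain ⟨C, hC⟩ := hAC.const_of_ae_hasDerivAt_zero (by
    filter_upwards [hg.ae_hasDerivAt_integral, (i1.add i2).ae_hasDerivAt_integral]
      with x h1 h2 hx
    have := ((hv x).mul (h1 hx a (by simp))).sub (h2 hx a (by simp))
    convert! this using 1
    ring)
  have ha := hC a (by simp)
  have hb := hC b (by simp)
  rw [← ha] at hb
  simp only [Pi.sub_apply, smul_eq_mul, Pi.mul_apply, intervalIntegral.integral_same,
    mul_zero, sub_zero] at hb
  rw [intervalIntegral.integral_add i1 i2] at hb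
  linear_combination -hb

/-! ### Elementary estimates. -/

lemma IsCompact.exists_bound_of_forall_isBigO {K : Set ℝ} (hK : IsCompact K) {f g : ℝ → ℂ}
    (h : ∀ x ∈ K, f =O[𝓝 x] g) : ∃ C : ℝ, 0 ≤ C ∧ ∀ x ∈ K, ‖f x‖ ≤ C * ‖g x‖ := by
  refine hK.induction_on (p := fun K => ∃ C : ℝ, 0 ≤ C ∧ ∀ x ∈ K, ‖f x‖ ≤ C * ‖g x‖)
    ⟨0, le_rfl, by simp⟩ ?_ ?_ ?_
  · rintro s t hst ⟨C, h0, hC⟩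
    exact ⟨C, h0, fun x hx => hC x (hst hx)⟩
  · rintro s t ⟨C, h0, hC⟩ ⟨D, h0', hD⟩
    refine ⟨max C D, le_max_of_le_left h0, ?_⟩
    rintro x (hx | hx)
    · exact (hC x hx).trans (by gcongr; exact le_max_left _ _)
    · exact (hD x hx).trans (by gcongr; exact le_max_right _ _)
  · intro x hx
    obtain ⟨C, hC0, hC⟩ := (h x hx).exists_nonneg
    exact ⟨_, mem_nhdsWithin_of_mem_nhds hC.bound, C, hC0, fun y hy => hy⟩

lemma isBigO_nhds_of_ne_zero {f g : ℝ → ℂ} (hf : Continuous f) (hg : Continuous g) {x : ℝ}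
    (hx : g x ≠ 0) : f =O[𝓝 x] g :=
  Asymptotics.isBigO_of_div_tendsto_nhds
    ((hg.continuousAt.eventually_ne hx).mono fun _ h h' => absurd h' h) _
    ((hf.tendsto x).div (hg.tendsto x) hx)

/-- The error |r - 1| is a difference of norms, so it is at most ‖z - rw‖. This makes bounds on the
Cauchy kernel uniform under radial approach. -/
lemma norm_sub_le_two_mul_norm_sub_mul {z w : ℂ} (hz : ‖z‖ = 1) (hw : ‖w‖ = 1) {r : ℝ}
    (hr : 0 ≤ r) : ‖z - w‖ ≤ 2 * ‖z - r * w‖ := by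
  have h1 : ‖z - w‖ ≤ ‖z - r * w‖ + ‖r * w - w‖ := by
    simpa using norm_add_le (z - r * w) (r * w - w)
  have h2 : ‖(r * w - w : ℂ)‖ = |r - 1| := by
    rw [show (r * w - w : ℂ) = ((r - 1 : ℝ) : ℂ) * w by push_cast; ring, norm_mul, hw,
      mul_one, Complex.norm_real, Real.norm_eq_abs]
  have h3 : |r - 1| ≤ ‖z - r * w‖ := by
    have := abs_norm_sub_norm_le (r * w : ℂ) z
    rw [norm_mul, hw, hz, mul_one, Complex.norm_real, Real.norm_eq_abs, abs_of_nonneg hr] at this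
    rwa [norm_sub_rev]
  linarith

lemma uIoc_zero_pi_subset : uIoc 0 Real.pi ⊆ Icc 0 Real.pi := by
  rw [uIoc_of_le Real.pi_pos.le]; exact Ioc_subset_Icc_self

/-! ### Spiral arcs and Cauchy integrals along one arc. -/

/-- The curve `x ↦ exp (α x)`, a piece of a logarithmic spiral. -/
noncomputable def spiral (α : ℂ) (x : ℝ) : ℂ := Complex.exp (α * x)

lemma continuous_spiral (α : ℂ) : Continuous (spiral α) := by unfold spiral; fun_prop

lemma spiral_ne_zero (α : ℂ) (x : ℝ) : spiral α x ≠ 0 := Complex.exp_ne_zero _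

lemma norm_spiral (α : ℂ) (x : ℝ) : ‖spiral α x‖ = Real.exp (α.re * x) := by
  simp [spiral, Complex.norm_exp]

lemma hasDerivAt_spiral (α : ℂ) (x : ℝ) : HasDerivAt (spiral α) (α * spiral α x) x := by
  have h := ((Complex.ofRealCLM.hasDerivAt (x := x)).const_mul α).cexp
  simp only [Complex.ofRealCLM_apply, Complex.ofReal_one, mul_one] at h
  rw [mul_comm]
  exact h

lemma spiral_zpow (α : ℂ) (n : ℤ) (x : ℝ) : spiral α x ^ n = spiral (n * α) x := by
  rw [spiral, spiral, ← Complex.exp_int_mul]; ring_nf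

lemma spiral_eq_norm_mul (α : ℂ) (x : ℝ) :
    spiral α x = (Real.exp (α.re * x) : ℂ) * spiral (α.im * Complex.I) x := by
  rw [spiral, spiral, Complex.ofReal_exp, ← Complex.exp_add]
  conv_lhs => rw [← Complex.re_add_im α]
  push_cast; ring_nf

lemma norm_spiral_im (τ x : ℝ) : ‖spiral (τ * Complex.I) x‖ = 1 := by
  simp [norm_spiral]

lemma one_le_norm_spiral {α : ℂ} (hα : 0 ≤ α.re) {x : ℝ} (hx : 0 ≤ x) :
    1 ≤ ‖spiral α x‖ := by
  rw [norm_spiral]; exact Real.one_le_exp (by positivity)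

lemma norm_spiral_le {α : ℂ} (hα : 0 ≤ α.re) {x : ℝ} (hx : x ≤ Real.pi) :
    ‖spiral α x‖ ≤ Real.exp (α.re * Real.pi) := by
  rw [norm_spiral]; gcongr

/-- The Cauchy type integral `∫ p z / (z - ζ)` along the arc of spiral `z = exp (α x)`. -/
noncomputable def spiralCauchy (α : ℂ) (p : ℝ → ℂ) (ζ : ℂ) : ℂ :=
  ∫ x in (0 : ℝ)..Real.pi, p x * (spiral α x / (spiral α x - ζ))

/-- The moments `∫ p zⁿ` along the arc of spiral `z = exp (α x)`. -/
noncomputable def spiralMoment (α : ℂ) (p : ℝ → ℂ) (n : ℤ) : ℂ :=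
  ∫ x in (0 : ℝ)..Real.pi, p x * spiral α x ^ n

/-- Serves both expansions of z/(z - ζ): v = 1, w = ζ/z for small ζ, and v = -z/ζ, w = z/ζ for large
ζ. -/
lemma hasSum_integral_mul_geometric {p w v : ℝ → ℂ} (hp : Continuous p) (hw : Continuous w)
    (hv : Continuous v)
    {r : ℝ} (hr0 : 0 ≤ r) (hr : r < 1) (hwr : ∀ x ∈ Icc 0 Real.pi, ‖w x‖ ≤ r) :
    HasSum (fun k : ℕ => ∫ x in (0 : ℝ)..Real.pi, p x * (v x * w x ^ k))
      (∫ x in (0 : ℝ)..Real.pi, p x * (v x * (1 - w x)⁻¹)) := by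
  refine intervalIntegral.hasSum_integral_of_dominated_convergence
    (fun k x => ‖p x‖ * (‖v x‖ * r ^ k)) (fun k => by fun_prop) (fun k => ?_) ?_ ?_ ?_
  · refine ae_of_all _ fun x hx => ?_
    rw [norm_mul, norm_mul, norm_pow]
    have := hwr x (uIoc_zero_pi_subset hx)
    gcongr
  · exact ae_of_all _ fun x _ => ((summable_geometric_of_lt_one hr0 hr).mul_left _).mul_left _
  · simp_rw [tsum_mul_left]
    exact (hp.norm.mul (hv.norm.mul continuous_const)).intervalIntegrable _ _
  · refine ae_of_all _ fun x hx => ?_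
    exact ((hasSum_geometric_of_norm_lt_one ((hwr x (uIoc_zero_pi_subset hx)).trans_lt hr)).mul_left _).mul_left _

lemma hasSum_spiralCauchy_of_norm_lt_one {α : ℂ} (hα : 0 ≤ α.re) {p : ℝ → ℂ}
    (hp : Continuous p) {ζ : ℂ} (hζ : ‖ζ‖ < 1) :
    HasSum (fun k : ℕ => ζ ^ k * spiralMoment α p (-k)) (spiralCauchy α p ζ) := by
  have h := hasSum_integral_mul_geometric (v := fun _ => 1) (w := fun x => ζ / spiral α x) hp
    (continuous_const.div (continuous_spiral α) (spiral_ne_zero α)) continuous_const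
    (norm_nonneg ζ) hζ (fun x hx => by
      rw [norm_div]
      exact div_le_self (norm_nonneg _) (one_le_norm_spiral hα hx.1))
  convert h using 1
  · funext k
    rw [spiralMoment, ← intervalIntegral.integral_const_mul]
    congr 1; funext x
    rw [zpow_neg, zpow_natCast, div_pow]; ring
  · rw [spiralCauchy]
    congr 1; funext x
    rw [one_mul, one_sub_div (spiral_ne_zero α x), inv_div]

lemma hasSum_spiralCauchy_of_lt_norm {α : ℂ} (hα : 0 ≤ α.re) {p : ℝ → ℂ}
    (hp : Continuous p) {ζ : ℂ} (hζ : Real.exp (α.re * Real.pi) < ‖ζ‖) :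
    HasSum (fun k : ℕ => -(ζ⁻¹ ^ (k + 1) * spiralMoment α p (k + 1))) (spiralCauchy α p ζ) := by
  have h0 : 0 < ‖ζ‖ := (Real.exp_pos _).trans hζ
  have hz : ζ ≠ 0 := norm_pos_iff.1 h0
  have h := hasSum_integral_mul_geometric (v := fun x => -(spiral α x / ζ))
    (w := fun x => spiral α x / ζ) hp
    ((continuous_spiral α).div_const _) ((continuous_spiral α).div_const _).neg
    (by positivity) ((div_lt_one h0).2 hζ) (fun x hx => by
      rw [norm_div]
      gcongr
      exact norm_spiral_le hα hx.2)
  convert h using 1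
  · funext k
    rw [spiralMoment, ← intervalIntegral.integral_const_mul, ← intervalIntegral.integral_neg]
    congr 1; funext x
    rw [zpow_add_one₀ (spiral_ne_zero α x), zpow_natCast, div_pow]; ring
  · rw [spiralCauchy]
    congr 1; funext x
    rw [one_sub_div hz, inv_div]
    -- If the denominator vanishes, both sides are 0 by the convention for division by zero.
    by_cases hx : ζ - spiral α x = 0
    · rw [hx, ← neg_sub, hx]; simp
    · have : spiral α x - ζ ≠ 0 := by rwa [← neg_sub, neg_ne_zero]
      field_simp
      ring

lemma differentiableAt_spiralCauchy {α : ℂ} {p : ℝ → ℂ} (hp : Continuous p) {ζ : ℂ}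
    (hζ : ζ ∉ spiral α '' Icc 0 Real.pi) : DifferentiableAt ℂ (spiralCauchy α p) ζ := by
  have hcl : IsClosed (spiral α '' Icc 0 Real.pi) :=
    (isCompact_Icc.image (continuous_spiral α)).isClosed
  obtain ⟨d, hd, hball⟩ := Metric.isOpen_iff.1 hcl.isOpen_compl ζ hζ
  -- Halving the distance d from ζ to the arc keeps the denominators away from zero on a whole ball,
  -- so one can differentiate under the integral.
  have hdist : ∀ x ∈ Icc 0 Real.pi, ∀ z ∈ Metric.ball ζ (d / 2), d / 2 ≤ ‖spiral α x - z‖ := by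
    intro x hx z hz
    have h1 : d ≤ dist (spiral α x) ζ := by
      by_contra! h
      exact hball (Metric.mem_ball.2 h) (mem_image_of_mem _ hx)
    have h2 := dist_triangle (spiral α x) z ζ
    rw [Metric.mem_ball] at hz
    rw [← dist_eq_norm]
    linarith
  have hmeas : ∀ z, Measurable fun x => p x * (spiral α x / (spiral α x - z)) := fun z => by
    have := (continuous_spiral α).measurable
    have := hp.measurable
    fun_prop
  have hmeas' : Measurable fun x => p x * (spiral α x / (spiral α x - ζ) ^ 2) := by
    have := (continuous_spiral α).measurable
    have := hp.measurable
    fun_prop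
  refine (intervalIntegral.hasDerivAt_integral_of_dominated_loc_of_deriv_le
    (s := Metric.ball ζ (d / 2))
    (F' := fun z x => p x * (spiral α x / (spiral α x - z) ^ 2))
    (bound := fun x => ‖p x‖ * (‖spiral α x‖ / (d / 2) ^ 2))
    (Metric.ball_mem_nhds _ (half_pos hd)) ?_ ?_ ?_ ?_ ?_ ?_).2.differentiableAt
  · exact Eventually.of_forall fun z => (hmeas z).aestronglyMeasurable
  · refine ContinuousOn.intervalIntegrable ?_
    rw [uIcc_of_le Real.pi_pos.le]
    refine hp.continuousOn.mul ((continuous_spiral α).continuousOn.div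
      ((continuous_spiral α).sub continuous_const).continuousOn fun x hx h => hζ ⟨x, hx, ?_⟩)
    exact sub_eq_zero.1 h
  · exact hmeas'.aestronglyMeasurable
  · refine ae_of_all _ fun x hx z hz => ?_
    have := hdist x (uIoc_zero_pi_subset hx) z hz
    rw [norm_mul, norm_div, norm_pow]
    gcongr
  · exact (hp.norm.mul ((continuous_spiral α).norm.div_const _)).intervalIntegrable _ _
  · refine ae_of_all _ fun x hx z hz => ?_
    have h0 : spiral α x - z ≠ 0 := by
      have := hdist x (uIoc_zero_pi_subset hx) z hz
      exact norm_pos_iff.1 (by linarith)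
    have := ((((hasDerivAt_id z).const_sub (spiral α x)).inv h0).const_mul
      (spiral α x)).const_mul (p x)
    convert! this using 1
    simp
    left
    ring

/-- The bound on p cancels the pole of the kernel, so the integrands are dominated by 2C for all r >
0, on either side of the curve. -/
lemma tendsto_spiralCauchy_radial {α : ℂ} {p : ℝ → ℂ} (hp : Continuous p)
    {R : ℝ} (hR : 0 < R) {w : ℂ} (hw : ‖w‖ = 1) {C : ℝ} (hC0 : 0 ≤ C)
    (hC : ∀ x ∈ Icc 0 Real.pi, ‖p x‖ ≤ C * ‖spiral (α.im * Complex.I) x - w‖) :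
    Tendsto (fun r : ℝ => spiralCauchy α p (r * (R * w))) (𝓝 1)
      (𝓝 (spiralCauchy α p (R * w))) := by
  refine intervalIntegral.tendsto_integral_filter_of_dominated_convergence
    (fun _ => 2 * C) ?_ ?_ intervalIntegrable_const ?_
  -- The kernel may have a pole on the arc, so measurability is used in place of continuity.
  · refine Eventually.of_forall fun z => ?_
    have := (continuous_spiral α).measurable
    have := hp.measurable
    exact Measurable.aestronglyMeasurable (by fun_prop)
  · filter_upwards [lt_mem_nhds zero_lt_one] with r hr
    refine ae_of_all _ fun x hx => ?_
    have hpx := hC x (uIoc_zero_pi_subset hx)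
    -- The kernel is homogeneous of degree 0: dividing by the modulus of the arc point leaves a unit
    -- vector against a positive multiple of w.
    have e : (r * (R * w) : ℂ) = (Real.exp (α.re * x) : ℂ) *
        (((r * R / Real.exp (α.re * x) : ℝ) : ℂ) * w) := by
      have : (Real.exp (α.re * x) : ℂ) ≠ 0 := by simp [Complex.ofReal_exp]
      push_cast
      push_cast at this
      field_simp
    have hr' : 0 ≤ r * R / Real.exp (α.re * x) := by positivity
    have h2 := norm_sub_le_two_mul_norm_sub_mul (norm_spiral_im α.im x) hw hr'
    rw [e, spiral_eq_norm_mul, ← mul_sub, mul_div_mul_left _ _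
      (by simp [Complex.ofReal_exp]), norm_mul, norm_div, norm_spiral_im]
    set D := ‖spiral (α.im * Complex.I) x - ((r * R / Real.exp (α.re * x) : ℝ) : ℂ) * w‖
    rcases eq_or_lt_of_le (norm_nonneg _ : 0 ≤ D) with hD | hD
    · rw [show D = 0 from hD.symm, div_zero, mul_zero]; positivity
    · rw [mul_one_div, div_le_iff₀ hD]
      calc ‖p x‖ ≤ _ := hpx
        _ ≤ C * (2 * D) := by gcongr
        _ = _ := by ring
  · refine ae_of_all _ fun x hx => ?_
    have hpx := hC x (uIoc_zero_pi_subset hx)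
    -- At the pole itself p vanishes, so the integrand is 0 for every r.
    by_cases hz : spiral α x - R * w = 0
    · have hp0 : p x = 0 := by
        have h1 : spiral α x = R * w := sub_eq_zero.1 hz
        have h2 : Real.exp (α.re * x) = R := by
          rw [← norm_spiral, h1, norm_mul, hw, mul_one, Complex.norm_real,
            Real.norm_eq_abs, abs_of_pos hR]
        rw [spiral_eq_norm_mul, h2] at h1
        have h3 := mul_left_cancel₀ (by exact_mod_cast hR.ne') h1
        rw [h3, sub_self, norm_zero, mul_zero] at hpx
        exact norm_le_zero_iff.1 hpx
      simp [hp0]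
    · have : Tendsto (fun r : ℝ => (spiral α x - r * (R * w) : ℂ)) (𝓝 1)
          (𝓝 (spiral α x - R * w)) := by
        have hc : Continuous fun r : ℝ => (spiral α x - r * (R * w) : ℂ) := by fun_prop
        simpa using hc.tendsto 1
      exact (tendsto_const_nhds.div this hz).const_mul _

/-! ### Geometry of the two arcs, and moments of constants. -/

lemma spiral_im_eq (τ x : ℝ) :
    spiral (τ * Complex.I) x = Real.cos (τ * x) + Real.sin (τ * x) * Complex.I := by
  rw [spiral, show (τ * Complex.I * x : ℂ) = ((τ * x : ℝ) : ℂ) * Complex.I by push_cast; ring,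
    Complex.exp_mul_I, Complex.ofReal_cos, Complex.ofReal_sin]

/-- The cosine is injective on [0, π] and determines the parameter; the sine is nonzero at the
interior point y and determines the sign. -/
lemma spiral_im_inj {σ τ x y : ℝ} (hσ : σ = 1 ∨ σ = -1) (hτ : τ = 1 ∨ τ = -1)
    (hx : x ∈ Icc 0 Real.pi) (hy : y ∈ Ioo 0 Real.pi)
    (h : spiral (σ * Complex.I) x = spiral (τ * Complex.I) y) : σ = τ ∧ x = y := by
  rw [spiral_im_eq, spiral_im_eq] at h
  have hc := congrArg Complex.re h
  have hs := congrArg Complex.im h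
  simp only [Complex.add_re, Complex.ofReal_re, Complex.mul_re, Complex.I_re, mul_zero,
    Complex.ofReal_im, Complex.I_im, mul_one, sub_self, add_zero, Complex.add_im,
    Complex.mul_im, zero_add] at hc hs
  have hcos : Real.cos x = Real.cos y := by
    rcases hσ with rfl | rfl <;> rcases hτ with rfl | rfl <;> simpa using hc
  have hxy : x = y := Real.injOn_cos hx ⟨hy.1.le, hy.2.le⟩ hcos
  refine ⟨?_, hxy⟩
  subst hxy
  have hpos := Real.sin_pos_of_mem_Ioo hy
  rcases hσ with rfl | rfl <;> rcases hτ with rfl | rfl <;>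
    simp only [one_mul, neg_mul, Real.sin_neg] at hs <;> linarith

/-- The two arcs have equal modulus at equal parameters, so a ray through an interior point of one
arc meets the curve only there. -/
lemma spiral_ne_mul_spiral {α β : ℂ} (hα : α.im = 1 ∨ α.im = -1) (hβ : β.im = 1 ∨ β.im = -1)
    (hre : α.re = β.re) {y r : ℝ} (hy : y ∈ Ioo 0 Real.pi) (hr : 0 < r) (hr1 : r ≠ 1) :
    (r * spiral β y : ℂ) ∉ spiral α '' Icc 0 Real.pi := by
  rintro ⟨x, hx, h⟩
  rw [spiral_eq_norm_mul α, spiral_eq_norm_mul β] at h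
  have hn := congrArg norm h
  simp only [norm_mul, norm_spiral_im, Complex.norm_real, Real.norm_eq_abs, Real.abs_exp,
    mul_one, abs_of_pos hr] at hn
  rw [hn, Complex.ofReal_mul, mul_assoc] at h
  have h1 := mul_left_cancel₀ (by exact_mod_cast hr.ne') h
  have h2 := mul_left_cancel₀ (by exact_mod_cast (Real.exp_pos _).ne') h1
  have := (spiral_im_inj hα hβ hx hy h2).2
  subst this
  rw [hre] at hn
  exact hr1 (mul_right_cancel₀ (Real.exp_pos _).ne' (by rw [← hn, one_mul]))

lemma spiral_pi_conj {α : ℂ} (hα : α.im = 1 ∨ α.im = -1) :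
    spiral (conj α) Real.pi = spiral α Real.pi := by
  rw [spiral_eq_norm_mul, spiral_eq_norm_mul α, spiral_im_eq, spiral_im_eq]
  rcases hα with h | h <;> simp [h]

/-- The right side depends only on the endpoint, which α and ᾱ share. Subtracting a constant from
both densities thus preserves the equality of moments for n ≠ 0. -/
lemma mul_spiralMoment_one {α : ℂ} {n : ℤ} (hn : n ≠ 0) :
    α * spiralMoment α (fun _ => 1) n = (spiral α Real.pi ^ n - 1) / n := by
  have hn' : (n : ℂ) ≠ 0 := by exact_mod_cast hn
  have hd : ∀ x ∈ uIcc 0 Real.pi,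
      HasDerivAt (fun x => spiral α x ^ n / n) (α * (1 * spiral α x ^ n)) x := fun x _ => by
    simp_rw [spiral_zpow]
    convert! (hasDerivAt_spiral (n * α) x).div_const (n : ℂ) using 1
    field_simp
  rw [spiralMoment, ← intervalIntegral.integral_const_mul,
    intervalIntegral.integral_eq_sub_of_hasDerivAt hd]
  · rw [sub_div]
    simp [spiral]
  · simp_rw [spiral_zpow]
    have := continuous_spiral (n * α)
    exact Continuous.intervalIntegrable (by fun_prop) _ _

lemma spiralMoment_sub_const {α : ℂ} {p : ℝ → ℂ} (hp : Continuous p) (k : ℂ) (n : ℤ) :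
    spiralMoment α (fun x => p x - k) n
      = spiralMoment α p n - k * spiralMoment α (fun _ => 1) n := by
  have hc : Continuous fun x => spiral α x ^ n := by
    simp_rw [spiral_zpow]; exact continuous_spiral _
  simp only [spiralMoment]
  rw [← intervalIntegral.integral_const_mul, ← intervalIntegral.integral_sub]
  · congr 1; funext x; ring
  · exact (hp.mul hc).intervalIntegrable _ _
  · exact Continuous.intervalIntegrable (by fun_prop) _ _

lemma spiralMoment_one_zero (α : ℂ) : spiralMoment α (fun _ => 1) 0 = Real.pi := by
  simp [spiralMoment]

/-! ### The Cauchy integral over the closed curve and its jump. -/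

/-- The Cauchy integral of `(p, q)` over the closed curve made of two spiral arcs. -/
noncomputable def pairCauchy (α : ℂ) (p q : ℝ → ℂ) (ζ : ℂ) : ℂ :=
  α * spiralCauchy α p ζ - conj α * spiralCauchy (conj α) q ζ

/-- The expansion at 0 involves the moments of order -k, k ≥ 0, and only k = 0 survives. -/
lemma pairCauchy_of_norm_lt_one {α : ℂ} (hα : 0 ≤ α.re) {p q : ℝ → ℂ} (hp : Continuous p)
    (hq : Continuous q) (hm : ∀ n : ℤ, n ≠ 0 →
      α * spiralMoment α p n = conj α * spiralMoment (conj α) q n)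
    {ζ : ℂ} (hζ : ‖ζ‖ < 1) :
    pairCauchy α p q ζ = α * spiralMoment α p 0 - conj α * spiralMoment (conj α) q 0 := by
  have h := ((hasSum_spiralCauchy_of_norm_lt_one hα hp hζ).mul_left α).sub
    ((hasSum_spiralCauchy_of_norm_lt_one (α := conj α) (by simpa using hα) hq hζ).mul_left
      (conj α))
  refine h.unique ?_
  convert hasSum_single 0 fun k hk => ?_ using 1
  · simp
  · linear_combination ζ ^ k * hm (-k) (by simpa using hk)

/-- The expansion at infinity involves only moments of order k + 1 ≥ 1, which all cancel. -/
lemma pairCauchy_of_lt_norm {α : ℂ} (hα : 0 ≤ α.re) {p q : ℝ → ℂ} (hp : Continuous p)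
    (hq : Continuous q) (hm : ∀ n : ℤ, n ≠ 0 →
      α * spiralMoment α p n = conj α * spiralMoment (conj α) q n)
    {ζ : ℂ} (hζ : Real.exp (α.re * Real.pi) < ‖ζ‖) : pairCauchy α p q ζ = 0 := by
  have h := ((hasSum_spiralCauchy_of_lt_norm hα hp hζ).mul_left α).sub
    ((hasSum_spiralCauchy_of_lt_norm (α := conj α) (by simpa using hα) hq
      (by simpa using hζ)).mul_left (conj α))
  refine h.unique ?_
  convert hasSum_zero using 1
  funext k
  linear_combination -(ζ⁻¹ ^ (k + 1)) * hm (k + 1) (by positivity)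

lemma analyticAt_pairCauchy {α : ℂ} {p q : ℝ → ℂ} (hp : Continuous p) (hq : Continuous q)
    {ζ : ℂ} (h1 : ζ ∉ spiral α '' Icc 0 Real.pi) (h2 : ζ ∉ spiral (conj α) '' Icc 0 Real.pi) :
    AnalyticAt ℂ (pairCauchy α p q) ζ := by
  have hcl (γ : ℂ) : IsClosed (spiral γ '' Icc 0 Real.pi) :=
    (isCompact_Icc.image (continuous_spiral γ)).isClosed
  refine DifferentiableOn.analyticAt (s := (spiral α '' Icc 0 Real.pi)ᶜ ∩
    (spiral (conj α) '' Icc 0 Real.pi)ᶜ) ?_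
    (((hcl _).isOpen_compl.inter (hcl _).isOpen_compl).mem_nhds ⟨h1, h2⟩)
  intro z hz
  exact (((differentiableAt_spiralCauchy hp hz.1).const_mul α).sub
    ((differentiableAt_spiralCauchy hq hz.2).const_mul _)).differentiableWithinAt

/-- Identity theorem for the real-analytic function of r obtained by restriction to a ray. -/
lemma pairCauchy_eqOn_ray {α z C : ℂ} {p q : ℝ → ℂ} (hp : Continuous p) (hq : Continuous q)
    {U : Set ℝ} (hU : IsPreconnected U)
    (h1 : ∀ r ∈ U, (r * z : ℂ) ∉ spiral α '' Icc 0 Real.pi)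
    (h2 : ∀ r ∈ U, (r * z : ℂ) ∉ spiral (conj α) '' Icc 0 Real.pi)
    {r₀ : ℝ} (hr₀ : r₀ ∈ U) (h : ∀ᶠ r : ℝ in 𝓝 r₀, pairCauchy α p q (r * z) = C) :
    ∀ r ∈ U, pairCauchy α p q (r * z) = C := by
  have hA : AnalyticOnNhd ℝ (fun r : ℝ => pairCauchy α p q (r * z)) U := by
    intro r hr
    have hf := (analyticAt_pairCauchy hp hq (h1 r hr) (h2 r hr)).restrictScalars (𝕜 := ℝ)
    have hg : AnalyticAt ℝ (fun r : ℝ => (r * z : ℂ)) r :=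
      (Complex.ofRealCLM.analyticAt r).mul analyticAt_const
    exact AnalyticAt.fun_comp hf hg
  exact hA.eqOn_of_preconnected_of_eventuallyEq analyticOnNhd_const hU hr₀ h

/-- A jump relation: if all moments of `(p, q)` but one vanish on the closed curve formed by the
arcs `exp (α x)` and `exp (ᾱ x)`, then `q` takes the same value at all its differentiability
points. -/
lemma eq_of_spiralMoment_eq {α : ℂ} (hα : 0 ≤ α.re) (hα' : α.im = 1 ∨ α.im = -1)
    {p q : ℝ → ℂ} (hp : Continuous p) (hq : Continuous q)
    (hm : ∀ n : ℤ, n ≠ 0 → α * spiralMoment α p n = conj α * spiralMoment (conj α) q n)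
    {y : ℝ} (hy : y ∈ Ioo 0 Real.pi) (hd : DifferentiableAt ℝ q y) :
    α * spiralMoment α p 0 - conj α * spiralMoment (conj α) q 0
      = (α - conj α) * Real.pi * q y := by
  -- Subtracting q(y) makes the density vanish at the crossing point, so the Cauchy integral has the
  -- same limit from both sides.
  set k := q y with hk
  have hα'' : (conj α).im = 1 ∨ (conj α).im = -1 := by
    rcases hα' with h | h <;> simp [h]
  have hp' : Continuous fun x => p x - k := hp.sub continuous_const
  have hq' : Continuous fun x => q x - k := hq.sub continuous_const
  have hm' : ∀ n : ℤ, n ≠ 0 → α * spiralMoment α (fun x => p x - k) n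
      = conj α * spiralMoment (conj α) (fun x => q x - k) n := by
    intro n hn
    have e1 := mul_spiralMoment_one (α := α) hn
    have e2 := mul_spiralMoment_one (α := conj α) hn
    rw [spiral_pi_conj hα'] at e2
    rw [spiralMoment_sub_const hp, spiralMoment_sub_const hq]
    linear_combination hm n hn - k * e1 + k * e2
  set w := spiral ((conj α).im * Complex.I) y with hw
  have hw1 : ‖w‖ = 1 := norm_spiral_im _ _
  set R := Real.exp ((conj α).re * y) with hR
  have hR0 : 0 < R := Real.exp_pos _
  have hz : spiral (conj α) y = R * w := spiral_eq_norm_mul _ _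
  have hoff1 : ∀ r : ℝ, 0 < r → r ≠ 1 → (r * (R * w) : ℂ) ∉ spiral α '' Icc 0 Real.pi := by
    intro r h0 h1
    rw [← hz]
    exact spiral_ne_mul_spiral hα' hα'' (by simp) hy h0 h1
  have hoff2 : ∀ r : ℝ, 0 < r → r ≠ 1 →
      (r * (R * w) : ℂ) ∉ spiral (conj α) '' Icc 0 Real.pi := by
    intro r h0 h1
    rw [← hz]
    exact spiral_ne_mul_spiral hα'' hα'' rfl hy h0 h1
  have hnorm : ∀ r : ℝ, 0 < r → ‖(r * (R * w) : ℂ)‖ = r * R := by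
    intro r hr
    rw [norm_mul, norm_mul, hw1, Complex.norm_real, Complex.norm_real, Real.norm_eq_abs,
      Real.norm_eq_abs, abs_of_pos hr, abs_of_pos hR0, mul_one]
  obtain ⟨C, hC0, hC⟩ := isCompact_Icc.exists_bound_of_forall_isBigO
    (K := Icc 0 Real.pi) (f := fun x => p x - k)
    (g := fun x => spiral (α.im * Complex.I) x - w) (by
      intro x hx
      have hne : spiral (α.im * Complex.I) x - w ≠ 0 := by
        intro h
        have := (spiral_im_inj hα' hα'' hx hy (sub_eq_zero.1 h)).1
        rw [Complex.conj_im] at this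
        rcases hα' with h | h <;> rw [h] at this <;> norm_num at this
      exact isBigO_nhds_of_ne_zero hp' ((continuous_spiral _).sub continuous_const) hne)
  obtain ⟨D, hD0, hD⟩ := isCompact_Icc.exists_bound_of_forall_isBigO
    (K := Icc 0 Real.pi) (f := fun x => q x - k)
    (g := fun x => spiral ((conj α).im * Complex.I) x - w) (by
      intro x hx
      by_cases hne : spiral ((conj α).im * Complex.I) x - w = 0
      · have hxy := (spiral_im_inj hα'' hα'' hx hy (sub_eq_zero.1 hne)).2
        subst hxy
        have hτ : ((conj α).im * Complex.I : ℂ) ≠ 0 := by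
          rcases hα'' with h | h <;> simp [h]
        have h1 := (hasDerivAt_spiral ((conj α).im * Complex.I) x)
        -- The unit-circle parametrization has nonzero derivative, so y - x is controlled by the
        -- chord; differentiability of q then controls q - k.
        have h2 : (fun y : ℝ => y - x) =O[𝓝 x]
            (fun y => spiral ((conj α).im * Complex.I) y - w) := by
          simpa [hw, prod_pure, Asymptotics.isBigO_map, Function.comp_def] using
            (h1.isTheta_sub (mul_ne_zero hτ (spiral_ne_zero _ _))).isBigO_symm
        exact hd.hasDerivAt.isBigO_sub.trans h2
      · exact isBigO_nhds_of_ne_zero hq' ((continuous_spiral _).sub continuous_const) hne)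
  have hlim : Tendsto (fun r : ℝ => pairCauchy α (fun x => p x - k) (fun x => q x - k)
      (r * (R * w))) (𝓝 1) (𝓝 (pairCauchy α (fun x => p x - k) (fun x => q x - k) (R * w))) :=
    ((tendsto_spiralCauchy_radial hp' hR0 hw1 hC0 hC).const_mul _).sub
      ((tendsto_spiralCauchy_radial hq' hR0 hw1 hD0 hD).const_mul _)
  have hin : ∀ r ∈ Ioo (0 : ℝ) 1, pairCauchy α (fun x => p x - k) (fun x => q x - k)
      (r * (R * w)) = α * spiralMoment α (fun x => p x - k) 0
        - conj α * spiralMoment (conj α) (fun x => q x - k) 0 := by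
    -- At this r the modulus rR is below 1, inside the disc of the power series.
    have hr₀ : 1 / (R + 1) ∈ Ioo (0 : ℝ) 1 :=
      ⟨by positivity, by rw [div_lt_one (by positivity)]; linarith⟩
    refine pairCauchy_eqOn_ray hp' hq' isPreconnected_Ioo
      (fun r hr => hoff1 r hr.1 hr.2.ne) (fun r hr => hoff2 r hr.1 hr.2.ne) hr₀ ?_
    have h1 : 1 / (R + 1) < 1 / R := by gcongr; linarith
    filter_upwards [lt_mem_nhds hr₀.1, gt_mem_nhds h1] with r h0 h2
    exact pairCauchy_of_norm_lt_one hα hp' hq' hm' (by rwa [hnorm r h0, ← lt_div_iff₀ hR0])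
  have hout : ∀ r ∈ Ioi (1 : ℝ), pairCauchy α (fun x => p x - k) (fun x => q x - k)
      (r * (R * w)) = 0 := by
    set M := Real.exp (α.re * Real.pi)
    have hM : 0 < M := Real.exp_pos _
    -- At this r the modulus rR exceeds M, the largest modulus on the curve.
    have hr₀ : M / R + 1 ∈ Ioi (1 : ℝ) := by
      have : 0 < M / R := by positivity
      simpa using this
    refine pairCauchy_eqOn_ray hp' hq' isPreconnected_Ioi
      (fun r hr => hoff1 r (zero_lt_one.trans hr) (ne_of_gt hr))
      (fun r hr => hoff2 r (zero_lt_one.trans hr) (ne_of_gt hr)) hr₀ ?_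
    filter_upwards [lt_mem_nhds (lt_add_one (M / R))] with r h0
    exact pairCauchy_of_lt_norm hα hp' hq' hm'
      (by rwa [hnorm r ((by positivity : 0 < M / R).trans h0), ← div_lt_iff₀ hR0])
  -- The value on the curve equals both the inner constant and the outer value 0.
  have l1 := tendsto_nhds_unique (hlim.mono_left nhdsWithin_le_nhds)
    (tendsto_const_nhds.congr' (l₁ := 𝓝[<] (1 : ℝ)) (by
      filter_upwards [Ioo_mem_nhdsLT zero_lt_one] with r hr using (hin r hr).symm))
  have l2 := tendsto_nhds_unique (hlim.mono_left nhdsWithin_le_nhds)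
    (tendsto_const_nhds.congr' (l₁ := 𝓝[>] (1 : ℝ)) (by
      filter_upwards [self_mem_nhdsWithin] with r hr using (hout r hr).symm))
  rw [l1, spiralMoment_sub_const hp, spiralMoment_sub_const hq, spiralMoment_one_zero,
    spiralMoment_one_zero] at l2
  linear_combination l2

/-! ### Vanishing moments and completeness. -/

/-- Two integrable functions are determined by their moments on the closed curve formed by the
arcs `exp (α x)` and `exp (ᾱ x)`. -/
lemma ae_eq_zero_of_integral_spiral_eq_zero {α : ℂ} (hα : 0 ≤ α.re)
    (hα' : α.im = 1 ∨ α.im = -1) {g₁ g₂ : ℝ → ℂ} (h₁ : Integrable g₁) (h₂ : Integrable g₂)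
    (hm : ∀ n : ℤ, (∫ x in (0 : ℝ)..Real.pi, spiral α x ^ n * g₁ x)
      + ∫ x in (0 : ℝ)..Real.pi, spiral (conj α) x ^ n * g₂ x = 0) :
    ∀ᵐ x ∂muI, g₂ x = 0 := by
  have hparts (γ : ℂ) (g : ℝ → ℂ) (hg : Integrable g) (n : ℤ) :
      ∫ x in (0 : ℝ)..Real.pi, spiral γ x ^ n * g x =
        spiral γ Real.pi ^ n * (∫ x in (0 : ℝ)..Real.pi, g x)
          - n * (γ * spiralMoment γ (fun x => ∫ y in (0 : ℝ)..x, g y) n) := by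
    simp_rw [spiralMoment, spiral_zpow]
    rw [integral_mul_eq_sub_integral_deriv_mul_primitive (hasDerivAt_spiral (n * γ))
      (continuous_const.mul (continuous_spiral _)) hg.intervalIntegrable,
      ← mul_assoc]
    congr 1
    rw [← intervalIntegral.integral_const_mul]
    congr 1; funext x; ring
  have hc₁ := intervalIntegral.continuous_primitive (fun a b => h₁.intervalIntegrable) 0
  have hc₂ := intervalIntegral.continuous_primitive (fun a b => h₂.intervalIntegrable) 0
  set p := fun x => ∫ y in (0 : ℝ)..x, g₁ y with hp
  -- The sign turns the vanishing sum of moments into an equality.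
  set q := fun x => -∫ y in (0 : ℝ)..x, g₂ y with hq
  have hqM (n : ℤ) : spiralMoment (conj α) q n
      = -spiralMoment (conj α) (fun x => ∫ y in (0 : ℝ)..x, g₂ y) n := by
    simp only [spiralMoment, hq, neg_mul, intervalIntegral.integral_neg]
  -- The moment n = 0 says that the total integrals cancel; since the arcs share their endpoint,
  -- this removes the boundary terms for every n.
  have h0 := hm 0
  rw [hparts _ _ h₁, hparts _ _ h₂] at h0
  simp only [zpow_zero, one_mul, Int.cast_zero, zero_mul, sub_zero] at h0
  have hM : ∀ n : ℤ, n ≠ 0 → α * spiralMoment α p n = conj α * spiralMoment (conj α) q n := by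
    intro n hn
    have hn' : (n : ℂ) ≠ 0 := by exact_mod_cast hn
    have h := hm n
    rw [hparts _ _ h₁, hparts _ _ h₂, spiral_pi_conj hα'] at h
    rw [hqM]
    refine mul_left_cancel₀ hn' ?_
    linear_combination -h + spiral α Real.pi ^ n * h0
  have hsub : (α - conj α) * Real.pi ≠ 0 := by
    refine mul_ne_zero ?_ (by exact_mod_cast Real.pi_pos.ne')
    rw [Complex.sub_conj]
    rcases hα' with h | h <;> simp [h]
  have hder := LocallyIntegrable.ae_hasDerivAt_integral h₂.locallyIntegrable
  set K := (α * spiralMoment α p 0 - conj α * spiralMoment (conj α) q 0)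
    / ((α - conj α) * Real.pi) with hK
  have hae : q =ᵐ[muI] fun _ => K := by
    filter_upwards [ae_restrict_mem measurableSet_Ioo, ae_restrict_of_ae hder] with y hy hd
    have := eq_of_spiralMoment_eq hα hα' hc₁ hc₂.neg hM hy (hd 0).neg.differentiableAt
    rw [hK, eq_div_iff hsub, mul_comm]
    exact this.symm
  -- By continuity q is constant on all of (0, π), so its derivative, a.e. -g₂, is zero.
  have heq := Measure.eqOn_open_of_ae_eq hae isOpen_Ioo hc₂.neg.continuousOn continuousOn_const
  filter_upwards [ae_restrict_mem measurableSet_Ioo, ae_restrict_of_ae hder] with y hy hd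
  have h3 : HasDerivAt q 0 y := (hasDerivAt_const y K).congr_of_eventuallyEq
    (heq.eventuallyEq_of_mem (Ioo_mem_nhds hy.1 hy.2))
  exact neg_eq_zero.1 ((hd 0).neg.unique h3)

lemma uPar_ne_zero {s t : ℝ} (ht : 0 < t) : uPar s t ≠ 0 := by
  intro h
  have := congrArg Complex.im h
  simp [uPar] at this
  exact ht.ne' this

lemma uPar_mul_conj (s t : ℝ) : uPar s t * conj (uPar s t) = ((s ^ 2 + t ^ 2 : ℝ) : ℂ) := by
  rw [Complex.mul_conj, Complex.normSq_apply]
  simp [uPar]; ring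

lemma eigval_div_uPar {s t : ℝ} (ht : 0 < t) (n : ℤ) :
    (eigval s t n : ℂ) / uPar s t = n * (s / t - Complex.I) := by
  have ht' : (t : ℂ) ≠ 0 := by exact_mod_cast ht.ne'
  rw [div_eq_iff (uPar_ne_zero ht), eigval, uPar]
  push_cast
  field_simp
  linear_combination (t ^ 2 : ℂ) * n * Complex.I_sq

lemma eigval_div_conj_uPar {s t : ℝ} (ht : 0 < t) (n : ℤ) :
    (eigval s t n : ℂ) / conj (uPar s t) = n * (s / t + Complex.I) := by
  have := congrArg conj (eigval_div_uPar (s := s) ht n)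
  simpa using this

lemma eigfunFun_zero {s t : ℝ} (ht : 0 < t) (n : ℤ) (x : ℝ) :
    eigfunFun s t n x 0 = spiral (s / t - Complex.I) x ^ n := by
  rw [spiral_zpow, ← eigval_div_uPar ht]
  simp [eigfunFun, spiral]; ring_nf

lemma eigfunFun_one {s t : ℝ} (ht : 0 < t) (n : ℤ) (x : ℝ) :
    eigfunFun s t n x 1 = spiral (s / t + Complex.I) x ^ n := by
  rw [spiral_zpow, ← eigval_div_conj_uPar ht]
  simp [eigfunFun, spiral]; ring_nf

lemma conj_spiral (α : ℂ) (x : ℝ) : conj (spiral α x) = spiral (conj α) x := by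
  simp [spiral, ← Complex.exp_conj]

lemma dense_span_eigfun {s t : ℝ} (hs : 0 < s) (ht : 0 < t) :
    Dense (Submodule.span ℂ (Set.range (eigfun s t)) : Set L2C2) := by
  rw [Submodule.dense_iff_topologicalClosure_eq_top, Submodule.topologicalClosure_eq_top_iff,
    eq_bot_iff]
  intro G hG
  rw [Submodule.mem_bot]
  set α : ℂ := s / t + Complex.I with hα
  have hcα : conj α = s / t - Complex.I := by simp [hα, sub_eq_add_neg]
  have hre : α.re = s / t := by
    rw [hα, ← Complex.ofReal_div]; simp
  have him : α.im = 1 := by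
    rw [hα, ← Complex.ofReal_div]; simp
  have hGi (i : Fin 2) : Integrable (fun x => G x i) muI :=
    ((EuclideanSpace.proj (𝕜 := ℂ) i).integrable_comp
      ((Lp.memLp G).integrable (by norm_num)))
  have hInt (i : Fin 2) : Integrable ((Ioo 0 Real.pi).indicator fun x => G x i) :=
    (integrable_indicator_iff measurableSet_Ioo).2 (hGi i)
  have hrepl (γ : ℂ) (n : ℤ) (i : Fin 2) :
      ∫ x in (0 : ℝ)..Real.pi, spiral γ x ^ n * (Ioo 0 Real.pi).indicator (fun x => G x i) x
        = ∫ x, spiral γ x ^ n * G x i ∂muI := by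
    rw [intervalIntegral.integral_of_le Real.pi_pos.le, integral_Ioc_eq_integral_Ioo]
    refine setIntegral_congr_fun measurableSet_Ioo fun x hx => ?_
    simp only [indicator_of_mem hx]
  have hmul (γ : ℂ) (n : ℤ) (i : Fin 2) :
      Integrable (fun x => spiral γ x ^ n * G x i) muI := by
    have hc : Continuous fun x => spiral γ x ^ n := by
      simp_rw [spiral_zpow]; exact continuous_spiral _
    obtain ⟨C, hC⟩ := (isCompact_Icc (a := (0 : ℝ)) (b := Real.pi)).exists_bound_of_continuousOn
      hc.continuousOn
    refine (hGi i).bdd_mul (c := C) hc.aestronglyMeasurable ?_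
    filter_upwards [ae_restrict_mem measurableSet_Ioo] with x hx
    exact hC x (Ioo_subset_Icc_self hx)
  -- The inner product conjugates `f_n`, so α goes with the first component and ᾱ with the second.
  have hm (n : ℤ) : (∫ x, spiral α x ^ n * G x 0 ∂muI)
      + ∫ x, spiral (conj α) x ^ n * G x 1 ∂muI = 0 := by
    have h := (Submodule.mem_orthogonal _ _).1 hG (eigfun s t n)
      (Submodule.subset_span (mem_range_self n))
    rw [L2.inner_def] at h
    rw [← integral_add (hmul _ _ _) (hmul _ _ _), ← h]
    refine integral_congr_ae ?_
    filter_upwards [(memLp_eigfunFun s t n).coeFn_toLp] with x hx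
    rw [eigfun, hx, PiLp.inner_apply, Fin.sum_univ_two, eigfunFun_zero ht, eigfunFun_one ht,
      RCLike.inner_apply, RCLike.inner_apply, map_zpow₀, map_zpow₀, conj_spiral, conj_spiral,
      ← hcα, Complex.conj_conj]
    ring
  have e1 : ∀ᵐ x ∂muI, (Ioo 0 Real.pi).indicator (fun x => G x 1) x = 0 := by
    refine ae_eq_zero_of_integral_spiral_eq_zero (α := α) (by rw [hre]; positivity)
      (Or.inl him) (hInt 0) (hInt 1) fun n => ?_
    rw [hrepl, hrepl, hm]
  have e0 : ∀ᵐ x ∂muI, (Ioo 0 Real.pi).indicator (fun x => G x 0) x = 0 := by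
    refine ae_eq_zero_of_integral_spiral_eq_zero (α := conj α)
      (by rw [Complex.conj_re, hre]; positivity)
      (Or.inr (by rw [Complex.conj_im, him])) (hInt 1) (hInt 0) fun n => ?_
    rw [hrepl, hrepl, Complex.conj_conj, add_comm, hm]
  refine Lp.ext ?_
  filter_upwards [e0, e1, Lp.coeFn_zero C2 2 muI, ae_restrict_mem measurableSet_Ioo]
    with x h0 h1 hz hx
  rw [indicator_of_mem hx] at h0 h1
  rw [hz]
  ext i
  fin_cases i
  · exact h0
  · exact h1

/-! ### Scalar weak derivatives and the equation f' = κf. -/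

/-- `g` is the weak derivative of the complex-valued function `f` on `(0, π)`. -/
def IsWeakDerivC (f g : ℝ → ℂ) : Prop :=
  ∀ η : ℝ → ℝ, ContDiff ℝ ∞ η → HasCompactSupport η → tsupport η ⊆ Ioo 0 Real.pi →
    ∫ x, deriv η x • f x ∂muI = - ∫ x, η x • g x ∂muI

lemma isWeakDeriv_iff {f g : L2C2} :
    IsWeakDeriv f g ↔ ∀ i, IsWeakDerivC (fun x => f x i) (fun x => g x i) := by
  have hproj (ζ : ℝ → ℝ) (hζ : Continuous ζ) (hc : HasCompactSupport ζ) (f : L2C2) (i : Fin 2) :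
      (∫ x, ζ x • f x ∂muI) i = ∫ x, ζ x • f x i ∂muI :=
    ((EuclideanSpace.proj i : C2 →L[ℂ] ℂ).integral_comp_comm
      (integrable_smul_L2C2 ζ hζ hc f)).symm
  constructor
  · intro h i η h1 h2 h3
    rw [← hproj _ (h1.continuous_deriv (by simp)) h2.deriv, ← hproj _ h1.continuous h2,
      h η h1 h2 h3, PiLp.neg_apply]
  · intro h η h1 h2 h3
    ext i
    rw [PiLp.neg_apply, hproj _ (h1.continuous_deriv (by simp)) h2.deriv,
      hproj _ h1.continuous h2, h i η h1 h2 h3]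

lemma IsWeakDerivC.congr_ae {f g f' g' : ℝ → ℂ} (h : IsWeakDerivC f g) (hf : f =ᵐ[muI] f')
    (hg : g =ᵐ[muI] g') : IsWeakDerivC f' g' := by
  intro η h1 h2 h3
  have e1 : ∫ x, deriv η x • f' x ∂muI = ∫ x, deriv η x • f x ∂muI :=
    integral_congr_ae (by filter_upwards [hf] with x hx; rw [hx])
  have e2 : ∫ x, η x • g' x ∂muI = ∫ x, η x • g x ∂muI :=
    integral_congr_ae (by filter_upwards [hg] with x hx; rw [hx])
  rw [e1, e2, h η h1 h2 h3]

lemma isWeakDerivC_spiral (κ : ℂ) : IsWeakDerivC (spiral κ) (fun x => κ * spiral κ x) := by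
  intro η h1 h2 h3
  have hη : Continuous η := h1.continuous
  have hη' : Continuous (deriv η) := h1.continuous_deriv (by simp)
  have hs := continuous_spiral κ
  have hd : ∀ x ∈ uIcc 0 Real.pi, HasDerivAt (fun x => η x • spiral κ x)
      (deriv η x • spiral κ x + η x • (κ * spiral κ x)) x := fun x _ => by
    rw [add_comm]
    exact (h1.differentiable (by simp) x).hasDerivAt.smul (hasDerivAt_spiral κ x)
  have i1 : Continuous fun x => deriv η x • spiral κ x := by fun_prop
  have i2 : Continuous fun x => η x • (κ * spiral κ x) := by fun_prop
  have h := intervalIntegral.integral_eq_sub_of_hasDerivAt hd ((i1.add i2).intervalIntegrable _ _)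
  rw [intervalIntegral.integral_add (i1.intervalIntegrable _ _) (i2.intervalIntegrable _ _),
    image_eq_zero_of_notMem_tsupport fun h => (h3 h).1.false,
    image_eq_zero_of_notMem_tsupport fun h => (h3 h).2.false, zero_smul, zero_smul, sub_self,
    intervalIntegral.integral_of_le Real.pi_pos.le, intervalIntegral.integral_of_le
    Real.pi_pos.le, integral_Ioc_eq_integral_Ioo, integral_Ioc_eq_integral_Ioo] at h
  exact eq_neg_of_add_eq_zero_left h

/-- A smooth function with integral zero and compact support in `(0, π)` is the derivative of
such a function. -/
lemma exists_primitive_of_integral_eq_zero {θ : ℝ → ℝ} (hθ : ContDiff ℝ ∞ θ)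
    (hc : HasCompactSupport θ) (hs : tsupport θ ⊆ Ioo 0 Real.pi) (h0 : ∫ x, θ x = 0) :
    ∃ η : ℝ → ℝ, ContDiff ℝ ∞ η ∧ HasCompactSupport η ∧ tsupport η ⊆ Ioo 0 Real.pi ∧
      deriv η = θ := by
  have hder : ∀ x, HasDerivAt (fun x => ∫ y in (0 : ℝ)..x, θ y) (θ x) x := fun x =>
    intervalIntegral.integral_hasDerivAt_right (hθ.continuous.intervalIntegrable _ _)
      (hθ.continuous.stronglyMeasurableAtFilter _ _) hθ.continuous.continuousAt
  have hderiv : deriv (fun x => ∫ y in (0 : ℝ)..x, θ y) = θ := funext fun x => (hder x).deriv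
  obtain ⟨a, b, ha, hab, hb, hsub⟩ : ∃ a b : ℝ, 0 < a ∧ a ≤ b ∧ b < Real.pi ∧
      tsupport θ ⊆ Icc a b := by
    rcases (tsupport θ).eq_empty_or_nonempty with he | hne
    · exact ⟨1, 1, one_pos, le_rfl, by linarith [Real.pi_gt_three], by simp [he]⟩
    · obtain ⟨a, ha⟩ := hc.isCompact.exists_isLeast hne
      obtain ⟨b, hb⟩ := hc.isCompact.exists_isGreatest hne
      exact ⟨a, b, (hs ha.1).1, ha.2 hb.1, (hs hb.1).2, fun x hx => ⟨ha.2 hx, hb.2 hx⟩⟩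
  have hzero : ∀ x, x ∉ Icc a b → θ x = 0 := fun x hx =>
    image_eq_zero_of_notMem_tsupport fun h => hx (hsub h)
  have hfull : ∫ y in (0 : ℝ)..b, θ y = 0 := by
    rw [intervalIntegral.integral_of_le (ha.le.trans hab)]
    refine (setIntegral_eq_integral_of_forall_compl_eq_zero fun x hx => ?_).trans h0
    exact hzero x fun h => hx ⟨ha.trans_le h.1, h.2⟩
  -- To the right of b the primitive vanishes because the total integral is zero.
  have hvan : ∀ x, x ∉ Icc a b → ∫ y in (0 : ℝ)..x, θ y = 0 := by
    intro x hx
    rcases lt_or_ge x a with h | h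
    · rw [intervalIntegral.integral_congr (g := fun _ => 0), intervalIntegral.integral_zero]
      intro y hy
      refine hzero y fun h' => ?_
      rcases le_total 0 x with h2 | h2
      · rw [uIcc_of_le h2] at hy; linarith [hy.2, h'.1]
      · rw [uIcc_of_ge h2] at hy; linarith [hy.2, h'.1]
    · have hbx : b < x := by
        by_contra! h'
        exact hx ⟨h, h'⟩
      rw [← intervalIntegral.integral_add_adjacent_intervals
        (hθ.continuous.intervalIntegrable 0 b) (hθ.continuous.intervalIntegrable b x), hfull,
        zero_add, intervalIntegral.integral_of_le hbx.le]
      exact setIntegral_eq_zero_of_forall_eq_zero fun y hy => hzero y fun h' =>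
        absurd hy.1 (not_lt.2 h'.2)
  have hsupp : tsupport (fun x => ∫ y in (0 : ℝ)..x, θ y) ⊆ Icc a b :=
    closure_minimal (fun x hx => by_contra fun h => hx (hvan x h)) isClosed_Icc
  refine ⟨fun x => ∫ y in (0 : ℝ)..x, θ y, ?_, ?_, hsupp.trans fun x hx =>
    ⟨ha.trans_le hx.1, hx.2.trans_lt hb⟩, hderiv⟩
  · rw [contDiff_infty_iff_deriv, hderiv]
    exact ⟨fun x => (hder x).differentiableAt, hθ⟩
  · exact isCompact_Icc.of_isClosed_subset (isClosed_tsupport _) hsupp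

lemma integrable_smul_muI {f : ℝ → ℂ} (hf : Integrable f muI) {ζ : ℝ → ℝ} (hζ : Continuous ζ)
    (hc : HasCompactSupport ζ) : Integrable (fun x => ζ x • f x) muI := by
  obtain ⟨C, hC⟩ := hc.exists_bound_of_continuous hζ
  exact hf.bdd_smul C hζ.aestronglyMeasurable (ae_of_all _ hC)

/-- The lemma of du Bois-Reymond on `(0, π)`. -/
lemma IsWeakDerivC.ae_eq_const {f : ℝ → ℂ} (hf : Integrable f muI)
    (h : IsWeakDerivC f fun _ => 0) : ∃ c : ℂ, f =ᵐ[muI] fun _ => c := by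
  have hpi := Real.pi_gt_three
  let b : ContDiffBump (Real.pi / 2) := ⟨1 / 2, 1, by norm_num, by norm_num⟩
  set χ := b.normed volume with hχ
  have hχ1 : ∫ x, χ x = 1 := b.integral_normed
  have hχC : ContDiff ℝ ∞ χ := b.contDiff_normed
  have hχc : HasCompactSupport χ := b.hasCompactSupport_normed
  have hχs : tsupport χ ⊆ Ioo 0 Real.pi := by
    rw [hχ, b.tsupport_normed_eq, Real.closedBall_eq_Icc]
    intro x hx
    have h1 : Real.pi / 2 - 1 ≤ x := hx.1
    have h2 : x ≤ Real.pi / 2 + 1 := hx.2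
    constructor <;> linarith
  set c := ∫ x, χ x • f x ∂muI with hc
  have hconst : Integrable (fun _ : ℝ => c) muI := integrable_const c
  refine ⟨c, ?_⟩
  have hloc : LocallyIntegrableOn (fun x => f x - c) (Ioo 0 Real.pi) volume :=
    IntegrableOn.locallyIntegrableOn (hf.sub hconst)
  have key := IsOpen.ae_eq_zero_of_integral_contDiff_smul_eq_zero isOpen_Ioo hloc ?_
  · rw [EventuallyEq, ae_restrict_iff' measurableSet_Ioo]
    filter_upwards [key] with x hx hx'
    exact sub_eq_zero.1 (hx hx')
  · intro ψ h1 h2 h3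
    -- Subtracting mχ gives integral zero, hence the derivative of a test function; this yields ∫ψf
    -- = mc.
    set m := ∫ x, ψ x with hm
    have hθs : tsupport (fun x => ψ x - m * χ x) ⊆ Ioo 0 Real.pi := by
      refine (tsupport_sub (f := ψ) (g := fun x => m * χ x)).trans (union_subset h3 ?_)
      exact (tsupport_mul_subset_right (f := fun _ => m) (g := χ)).trans hχs
    have hθc : HasCompactSupport (fun x => ψ x - m * χ x) :=
      h2.sub hχc.mul_left
    obtain ⟨η, e1, e2, e3, e4⟩ := exists_primitive_of_integral_eq_zero
      (θ := fun x => ψ x - m * χ x) (h1.sub (contDiff_const.mul hχC)) hθc hθs (by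
        rw [integral_sub (h1.continuous.integrable_of_hasCompactSupport h2)
          ((hχC.continuous.integrable_of_hasCompactSupport hχc).const_mul m),
          integral_const_mul, hχ1, mul_one, sub_self])
    have hw := h η e1 e2 e3
    simp only [e4, smul_zero, integral_zero, neg_zero] at hw
    have i1 := integrable_smul_muI hf h1.continuous h2
    have i2 := integrable_smul_muI hf hχC.continuous hχc
    have j2 : Integrable (fun x => m • χ x • f x) muI := i2.smul m
    have i3 := integrable_smul_muI hconst h1.continuous h2
    have hw' : ∫ x, ψ x • f x ∂muI = m • c := by
      rw [hc, ← integral_smul, ← sub_eq_zero, ← integral_sub i1 j2, ← hw]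
      congr 1; funext x
      rw [sub_smul, mul_smul]
    have hmI : ∫ x, ψ x ∂muI = m :=
      setIntegral_eq_integral_of_forall_compl_eq_zero fun x hx =>
        image_eq_zero_of_notMem_tsupport fun h => hx (h3 h)
    have h4 : ∫ x in Ioo 0 Real.pi, ψ x • (f x - c) = 0 := by
      simp_rw [smul_sub]
      rw [integral_sub i1 i3, hw', integral_smul_const, hmI, sub_self]
    rw [← h4]
    refine (setIntegral_eq_integral_of_forall_compl_eq_zero fun x hx => ?_).symm
    rw [image_eq_zero_of_notMem_tsupport fun h => hx (h3 h), zero_smul]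

/-- Weak solutions of `f' = κ f` on `(0, π)` are multiples of `exp (κ x)`. -/
lemma IsWeakDerivC.ae_eq_mul_spiral {f : ℝ → ℂ} {κ : ℂ} (hf : Integrable f muI)
    (h : IsWeakDerivC f fun x => κ * f x) : ∃ c : ℂ, f =ᵐ[muI] fun x => c * spiral κ x := by
  set E := spiral (-κ) with hE
  have hEd : ∀ x, HasDerivAt E (-κ * E x) x := hasDerivAt_spiral (-κ)
  have hEC : ContDiff ℝ ∞ E := by
    have : ContDiff ℝ ∞ fun x : ℝ => (x : ℂ) := Complex.ofRealCLM.contDiff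
    exact (contDiff_const.mul this).cexp
  have hEre : ContDiff ℝ ∞ fun x => (E x).re := Complex.reCLM.contDiff.comp hEC
  have hEim : ContDiff ℝ ∞ fun x => (E x).im := Complex.imCLM.contDiff.comp hEC
  have hEint : Integrable (fun x => E x * f x) muI := by
    obtain ⟨C, hC⟩ := (isCompact_Icc (a := (0 : ℝ)) (b := Real.pi)).exists_bound_of_continuousOn
      hEC.continuous.continuousOn
    refine hf.bdd_mul (c := C) hEC.continuous.aestronglyMeasurable ?_
    filter_upwards [ae_restrict_mem measurableSet_Ioo] with x hx
    exact hC x (Ioo_subset_Icc_self hx)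
  have hw : IsWeakDerivC (fun x => E x * f x) fun _ => 0 := by
    intro η h1 h2 h3
    -- Test functions are real, so the factor E is inserted through its real and imaginary parts and
    -- reassembled with `Complex.I`.
    have test (e : ℝ → ℝ) (he : ContDiff ℝ ∞ e) :
        Integrable (fun x => deriv (fun x => η x * e x) x • f x) muI ∧
        Integrable (fun x => (η x * e x) • (κ * f x)) muI ∧
        ∫ x, deriv (fun x => η x * e x) x • f x ∂muI
          = -∫ x, (η x * e x) • (κ * f x) ∂muI := by
      have c1 : ContDiff ℝ ∞ fun x => η x * e x := h1.mul he
      have c2 : HasCompactSupport fun x => η x * e x := h2.mul_right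
      exact ⟨integrable_smul_muI hf (c1.continuous_deriv (by simp)) c2.deriv,
        integrable_smul_muI (hf.const_mul κ) c1.continuous c2,
        h _ c1 c2 ((tsupport_mul_subset_left (f := η) (g := e)).trans h3)⟩
    obtain ⟨r1, r2, r3⟩ := test _ hEre
    obtain ⟨s1, s2, s3⟩ := test _ hEim
    have hsum : ∫ x, (deriv (fun x => η x * (E x).re) x • f x
          + Complex.I * (deriv (fun x => η x * (E x).im) x • f x)) ∂muI
        = -∫ x, ((η x * (E x).re) • (κ * f x)
          + Complex.I * ((η x * (E x).im) • (κ * f x))) ∂muI := by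
      rw [integral_add r1 (s1.const_mul _), integral_add r2 (s2.const_mul _),
        integral_const_mul, integral_const_mul, r3, s3]
      ring
    have j1 : Integrable (fun x => deriv (fun x => η x * (E x).re) x • f x
        + Complex.I * (deriv (fun x => η x * (E x).im) x • f x)) muI := r1.add (s1.const_mul _)
    have j2 : Integrable (fun x => (η x * (E x).re) • (κ * f x)
        + Complex.I * ((η x * (E x).im) • (κ * f x))) muI := r2.add (s2.const_mul _)
    rw [← sub_eq_zero, sub_neg_eq_add, ← integral_add j1 j2] at hsum
    simp only [smul_zero, integral_zero, neg_zero]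
    rw [← hsum]
    congr 1; funext x
    have hη := (h1.differentiable (by simp) x).hasDerivAt
    have d1 : HasDerivAt (fun x => (E x).re) (-κ * E x).re x :=
      Complex.reCLM.hasFDerivAt.comp_hasDerivAt x (hEd x)
    have d2 : HasDerivAt (fun x => (E x).im) (-κ * E x).im x :=
      Complex.imCLM.hasFDerivAt.comp_hasDerivAt x (hEd x)
    have e1 := Complex.re_add_im (E x)
    have e2 := Complex.re_add_im (-κ * E x)
    simp only [(hη.fun_mul d1).deriv, (hη.fun_mul d2).deriv, Complex.real_smul,
      Complex.ofReal_add, Complex.ofReal_mul]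
    linear_combination (-((deriv η x : ℝ) : ℂ) * f x - η x * κ * f x) * e1 - η x * f x * e2
  obtain ⟨c, hc⟩ := hw.ae_eq_const hEint
  refine ⟨c, ?_⟩
  filter_upwards [hc] with x hx
  have : E x * spiral κ x = 1 := by
    rw [hE, spiral, spiral, ← Complex.exp_add]; simp
  linear_combination spiral κ x * hx - f x * this

/-! ### Eigenvalues and eigenfunctions. -/

lemma isEigenvector_opL_iff {s t : ℝ} {z : ℂ} {f : L2C2} :
    IsEigenvector (opL s t) z f ↔ f ≠ 0 ∧ (f, z • f) ∈ graphL s t := by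
  rw [IsEigenvector, ← graph_opL, LinearPMap.mem_graph_iff]
  refine and_congr_right fun _ => ⟨?_, ?_⟩
  · rintro ⟨hf, h⟩
    exact ⟨⟨f, hf⟩, rfl, h⟩
  · rintro ⟨⟨y, hy⟩, rfl, h⟩
    exact ⟨hy, h⟩

lemma eigfun_ne_zero {s t : ℝ} (ht : 0 < t) (n : ℤ) : eigfun s t n ≠ 0 := by
  intro h
  have h1 := (memLp_eigfunFun s t n).coeFn_toLp
  rw [← eigfun, h] at h1
  have hF : ∀ᵐ _x ∂muI, False := by
    filter_upwards [h1, Lp.coeFn_zero C2 2 muI] with x hx h0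
    have h2 := eigfunFun_zero (s := s) ht n x
    rw [← hx, h0] at h2
    exact zpow_ne_zero n (spiral_ne_zero _ x) h2.symm
  rw [eventually_false_iff_eq_bot, ae_eq_bot, Measure.restrict_eq_zero, Real.volume_Ioo,
    ENNReal.ofReal_eq_zero] at hF
  linarith [Real.pi_pos]

lemma spiral_zpow_pi_eq (s t : ℝ) (n : ℤ) :
    spiral (s / t - Complex.I) Real.pi ^ n = spiral (s / t + Complex.I) Real.pi ^ n := by
  have him : (s / t + Complex.I : ℂ).im = 1 := by
    rw [← Complex.ofReal_div]; simp
  have hc : conj (s / t + Complex.I : ℂ) = s / t - Complex.I := by simp [sub_eq_add_neg]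
  rw [← hc, spiral_pi_conj (Or.inl him)]

lemma isEigenvector_eigfun {s t : ℝ} (ht : 0 < t) (n : ℤ) :
    IsEigenvector (opL s t) (eigval s t n) (eigfun s t n) := by
  refine isEigenvector_opL_iff.2 ⟨eigfun_ne_zero ht n, ⟨eigfunFun s t n,
    (continuous_eigfunFun s t n).continuousOn, (memLp_eigfunFun s t n).coeFn_toLp, ?_, ?_⟩, ?_⟩
  · rw [eigfunFun_zero ht, eigfunFun_one ht]
    simp [spiral]
  · rw [eigfunFun_zero ht, eigfunFun_one ht, spiral_zpow_pi_eq]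
  · set κ : Fin 2 → ℂ := ![eigval s t n / uPar s t, eigval s t n / conj (uPar s t)] with hκ
    have hF (i : Fin 2) : (fun x => eigfunFun s t n x i) = spiral (κ i) := by
      funext x
      fin_cases i <;> simp [eigfunFun, spiral, hκ] <;> ring_nf
    have hmem : MemLp (fun x => WithLp.toLp 2 fun i => κ i * eigfunFun s t n x i : ℝ → C2)
        2 muI := by
      have hc : Continuous (fun x => WithLp.toLp 2 fun i => κ i * eigfunFun s t n x i :
          ℝ → C2) := by
        refine (PiLp.continuous_toLp 2 _).comp (continuous_pi fun i => ?_)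
        have := continuous_spiral (κ i)
        rw [← hF i] at this
        exact continuous_const.mul this
      obtain ⟨C, hC⟩ := (isCompact_Icc (a := (0 : ℝ)) (b := Real.pi)).exists_bound_of_continuousOn
        hc.continuousOn
      refine MemLp.of_bound hc.aestronglyMeasurable C ?_
      filter_upwards [ae_restrict_mem measurableSet_Ioo] with x hx
      exact hC x (Ioo_subset_Icc_self hx)
    refine ⟨hmem.toLp _, isWeakDeriv_iff.2 fun i => ?_, ?_⟩
    · refine (isWeakDerivC_spiral (κ i)).congr_ae ?_ ?_
      · filter_upwards [(memLp_eigfunFun s t n).coeFn_toLp] with x hx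
        rw [eigfun, hx, ← hF i]
      · filter_upwards [hmem.coeFn_toLp] with x hx
        rw [hx, ← hF i]
    · have hu := uPar_ne_zero (s := s) ht
      have hu' : conj (uPar s t) ≠ 0 := (map_ne_zero _).2 hu
      filter_upwards [hmem.coeFn_toLp, (memLp_eigfunFun s t n).coeFn_toLp,
        Lp.coeFn_smul (eigval s t n : ℂ) (eigfun s t n)] with x h1 h2 h3
      rw [h1, h3, Pi.smul_apply, eigfun, h2]
      constructor
      · simp only [hκ, PiLp.smul_apply, smul_eq_mul, Matrix.cons_val_zero]
        field_simp
      · simp only [hκ, PiLp.smul_apply, smul_eq_mul, Matrix.cons_val_one, Matrix.cons_val_fin_one]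
        field_simp

lemma eq_eigval_of_spiral_pi_eq {s t : ℝ} (ht : 0 < t) {z : ℂ}
    (h : spiral (z / uPar s t) Real.pi = spiral (z / conj (uPar s t)) Real.pi) :
    ∃ n : ℤ, z = eigval s t n := by
  have hu := uPar_ne_zero (s := s) ht
  have hu' : conj (uPar s t) ≠ 0 := (map_ne_zero _).2 hu
  have ht' : (t : ℂ) ≠ 0 := by exact_mod_cast ht.ne'
  have hpi : (Real.pi : ℂ) ≠ 0 := by exact_mod_cast Real.pi_pos.ne'
  obtain ⟨m, hm⟩ := Complex.exp_eq_exp_iff_exists_int.1 h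
  -- The sign comes from ū - u = -2it.
  refine ⟨-m, ?_⟩
  have h1 : z / uPar s t = z / conj (uPar s t) + m * (2 * Complex.I) :=
    mul_right_cancel₀ hpi (by linear_combination hm)
  have h2 : z * (conj (uPar s t) - uPar s t)
      = m * (2 * Complex.I) * (uPar s t * conj (uPar s t)) := by
    field_simp at h1
    linear_combination h1
  have h3 : conj (uPar s t) - uPar s t = -(2 * Complex.I) * t := by
    simp [uPar]; ring
  rw [h3, uPar_mul_conj] at h2
  have h4 : z * t = -m * ((s ^ 2 + t ^ 2 : ℝ) : ℂ) :=
    mul_left_cancel₀ (a := 2 * Complex.I) (by simp) (by linear_combination -h2)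
  rw [eigval]
  push_cast at h4 ⊢
  rw [eq_div_iff ht', h4]
  ring

lemma eq_smul_eigfun_of_isEigenvector {s t : ℝ} (ht : 0 < t) {z : ℂ} {f : L2C2}
    (h : IsEigenvector (opL s t) z f) :
    ∃ (n : ℤ) (c : ℂ), z = (eigval s t n : ℂ) ∧ f = c • eigfun s t n := by
  obtain ⟨hf0, ⟨φ, hφ, hfφ, hb0, hb1⟩, g, hg, hh⟩ := isEigenvector_opL_iff.1 h
  have hu := uPar_ne_zero (s := s) ht
  have hu' : conj (uPar s t) ≠ 0 := (map_ne_zero _).2 hu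
  set κ : Fin 2 → ℂ := ![z / uPar s t, z / conj (uPar s t)] with hκ
  have hgκ (i : Fin 2) : (fun x => g x i) =ᵐ[muI] fun x => κ i * f x i := by
    filter_upwards [hh, Lp.coeFn_smul z f] with x hx h1
    simp only [h1, Pi.smul_apply, PiLp.smul_apply, smul_eq_mul] at hx
    fin_cases i
    · simp only [hκ, Fin.zero_eta, Matrix.cons_val_zero]
      field_simp
      linear_combination -hx.1
    · simp only [hκ, Fin.mk_one, Matrix.cons_val_one, Matrix.cons_val_fin_one]
      field_simp
      linear_combination -hx.2
  have hfi (i : Fin 2) : Integrable (fun x => f x i) muI :=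
    ((EuclideanSpace.proj (𝕜 := ℂ) i).integrable_comp
      ((Lp.memLp f).integrable (by norm_num)))
  have hsol (i : Fin 2) : ∃ c : ℂ, (fun x => f x i) =ᵐ[muI] fun x => c * spiral (κ i) x :=
    ((isWeakDeriv_iff.1 hg i).congr_ae (ae_eq_refl _) (hgκ i)).ae_eq_mul_spiral (hfi i)
  choose c hc using hsol
  -- Continuity extends the a.e. identity to the closed interval, so the boundary conditions apply
  -- to the exponentials.
  have hφc (i : Fin 2) : EqOn (fun x => φ x i) (fun x => c i * spiral (κ i) x)
      (Icc 0 Real.pi) := by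
    refine Measure.eqOn_Icc_of_ae_eq volume Real.pi_pos.ne ?_
      ((EuclideanSpace.proj (𝕜 := ℂ) i).continuous.comp_continuousOn hφ)
      (continuous_const.mul (continuous_spiral _)).continuousOn
    rw [← Measure.restrict_congr_set Ioo_ae_eq_Icc]
    filter_upwards [hfφ, hc i] with x h1 h2
    rw [← h1, h2]
  have hpi := Real.pi_pos.le
  have e0 (i : Fin 2) : φ 0 i = c i := by
    simpa [spiral] using hφc i (left_mem_Icc.2 hpi)
  have e1 (i : Fin 2) : φ Real.pi i = c i * spiral (κ i) Real.pi :=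
    hφc i (right_mem_Icc.2 hpi)
  rw [e0, e0] at hb0
  rw [e1, e1, ← hb0] at hb1
  have hc0 : c 0 ≠ 0 := by
    intro h0
    refine hf0 (Lp.ext ?_)
    filter_upwards [hc 0, hc 1, Lp.coeFn_zero C2 2 muI] with x h1 h2 h3
    rw [← hb0, h0, zero_mul] at h2
    rw [h0, zero_mul] at h1
    rw [h3]
    ext i
    fin_cases i
    · exact h1
    · exact h2
  obtain ⟨n, rfl⟩ := eq_eigval_of_spiral_pi_eq ht (mul_left_cancel₀ hc0 hb1)
  refine ⟨n, c 0, rfl, Lp.ext ?_⟩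
  filter_upwards [hc 0, hc 1, Lp.coeFn_smul (c 0) (eigfun s t n),
    (memLp_eigfunFun s t n).coeFn_toLp] with x h1 h2 h3 h4
  rw [h3, Pi.smul_apply, eigfun, h4]
  ext i
  fin_cases i
  · refine h1.trans ?_
    rw [PiLp.smul_apply, smul_eq_mul, Fin.zero_eta, eigfunFun_zero ht, spiral_zpow,
      ← eigval_div_uPar ht]
    rfl
  · refine h2.trans ?_
    rw [PiLp.smul_apply, smul_eq_mul, Fin.mk_one, eigfunFun_one ht, spiral_zpow,
      ← eigval_div_conj_uPar ht, ← hb0]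
    rfl

theorem theorem19 (s t : ℝ) (hs : 0 < s) (ht : 0 < t) :
    (∀ n : ℤ, IsEigenvector (opL s t) (eigval s t n : ℂ) (eigfun s t n)) ∧
    (∀ (z : ℂ) (f : L2C2), IsEigenvector (opL s t) z f →
      ∃ (n : ℤ) (c : ℂ), z = (eigval s t n : ℂ) ∧ f = c • eigfun s t n) ∧
    Dense (Submodule.span ℂ (Set.range (eigfun s t)) : Set L2C2) :=
  ⟨isEigenvector_eigfun ht, fun _ _ => eq_smul_eigfun_of_isEigenvector ht,
    dense_span_eigfun hs ht⟩
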